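/- Let $\{(x_i,y_i)\}_{i=1}^n$, $n\ge 1$, $x_i\in\mathbb{R}^d$, $y_i\in\{-1,1\}$, be a linearly separable dataset: some $w$ satisfies $y_i w^\top x_i>0$ for all $i$ (a bias term is represented by a constant coordinate of the $x_i$). Let $\mathcal L(w)=\frac1n\sum_{i=1}^n \exp(-y_i w^\top x_i)$ be the empirical risk with the exponential loss. For a norm $\|\cdot\|$ on $\mathbb{R}^d$ let $\|\delta\|_*=\sup\{|\langle\delta,v\rangle| : \|v\|\le 1\}$ be its dual norm. *Steepest descent* on $\mathcal L$ with respect to $\|\cdot\|$ is any sequence $w_{t+1}=w_t+\gamma_t\Delta_t$ with $w_0\in\mathbb{R}^d$ arbitrary and $\Delta_t\in\operatorname{argmin}_v\ \langle\nabla\mathcal L(w_t),v\rangle+\frac12\|v\|^2$. The step sizes are *admissible* if $\gamma_t>0$, $\sum_t\gamma_t=\infty$ and, for some constant $\eta_+<\infty$, $\gamma_t\le\min\{\eta_+,\ 1/(B^2\mathcal L(w_t))\}$ for all $t$, where $B=\max_i\|x_i\|_*$. For a norm $\|\cdot\|_P$ on $\mathbb{R}^d$, the *robustness* $\rho_P(w)$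 of $w\in\mathbb{R}^d$ is the supremum of all $\varepsilon\ge 0$ such that $y_i w^\top(x_i+\delta)>0$ for all $i$ and all $\delta$ with $\|\delta\|_P\le\varepsilon$ (and $0$ if there is no such $\varepsilon$); $w$ is *maximally robust* against $\|\cdot\|_P$ if it maximizes $\rho_P$ over $\mathbb{R}^d$. **Theorem.** For every norm $\|\cdot\|$, all steepest descent iterates $w_t$ on $\mathcal L$ with respect to $\|\cdot\|$ with admissible step sizes converge in direction to maximal robustness against the dual norm $\|\cdot\|_*$, in the following sense: 1. the distance of $w_t/\|w_t\|$ to the set of maximally robust classifiers $v$ with $\|v\|=1$ tends to $0$ as $t\to\infty$; 2. every limit point $v$ of $w_t/\|w_t\|$ satisfies $\|v\|=1$ and is maximally robust; 3. $\rho_*(w_t)\to\max_{w}\rho_*(w)$, where $\rho_*$ is the robustness with respect to $\|\cdot\|_*$; 4. if there is only one maximally robust classifier $v$ with $\|v\|=1$, then $w_t/\|w_t\|\to v$. In particular, with admissible step sizes (where $B$ is measured in $\ell_1$, $\ell_2$, $\ell_\infty$, respectively), (1)–(4) hold - for sign gradient descent, $w_{t+1}=w_t-\gamma_t\|\nabla\mathcal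 L(w_t)\|_1\operatorname{sign}(\nabla\mathcal L(w_t))$, with normalization in $\ell_\infty$ and perturbations bounded in $\ell_1$; - for gradient descent, $w_{t+1}=w_t-\gamma_t\nabla\mathcal L(w_t)$, with normalization and perturbations in $\ell_2$; here moreover $w_t/\|w_t\|_2$ always converges to a maximally robust classifier; - for coordinate descent, $w_{t+1}=w_t-\gamma_t(\nabla\mathcal L(w_t))_i e_i$ with $i$ any coordinate (depending on $t$) where $|(\nabla\mathcal L(w_t))_i|$ is largest, with normalization in $\ell_1$ and perturbations bounded in $\ell_\infty$. -/

import Mathlib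

open Filter Topology

noncomputable section

namespace ImplicitRobustness

/-- The space `ℝ^d`, with its standard inner product. -/
abbrev Vec (d : ℕ) : Type := EuclideanSpace ℝ (Fin d)

/-- The `ℓ₁` norm. -/
def l1Norm {d : ℕ} (v : Vec d) : ℝ := ∑ j, |v j|

/-- The `ℓ₂` norm. -/
def l2Norm {d : ℕ} (v : Vec d) : ℝ := Real.sqrt (∑ j, (v j) ^ 2)

/-- The `ℓ_∞` norm. -/
def lInfNorm {d : ℕ} (v : Vec d) : ℝ := ⨆ j, |v j|

/-- The dual norm `‖δ‖_* = sup {|⟨δ, v⟩| : ‖v‖ ≤ 1}`. -/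
def dualNorm {d : ℕ} (N : Vec d → ℝ) (δ : Vec d) : ℝ :=
  sSup {r : ℝ | ∃ v : Vec d, N v ≤ 1 ∧ r = |inner ℝ δ v|}

/-- The data set is strictly classified by some linear classifier `v ↦ ⟨w, v⟩`. (A bias is
expressed by a constant coordinate of the features.) -/
def LinearlySeparable {n d : ℕ} (x : Fin n → Vec d) (y : Fin n → ℝ) : Prop :=
  ∃ w : Vec d, ∀ i, 0 < y i * inner ℝ w (x i)

/-- The empirical risk of a linear classifier: the mean loss over the data set, for the
exponential loss `ζ(z) = exp (-z)`. -/
def expRisk {n d : ℕ} (x : Fin n → Vec d) (y : Fin n → ℝ) (w : Vec d) : ℝ :=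
  (∑ i, Real.exp (-(y i * inner ℝ w (x i)))) / n

/-- Steepest descent on `f` with respect to the norm `N`, with step sizes `γ`:
`w (t+1) = w t + γ t • Δ`, with `Δ ∈ argmin_v ⟨∇ f (w t), v⟩ + ‖v‖² / 2` (any minimizer). -/
def IsSteepestDescent {d : ℕ} (N : Vec d → ℝ) (f : Vec d → ℝ) (γ : ℕ → ℝ) (w : ℕ → Vec d) :
    Prop :=
  ∀ t, ∃ Δ : Vec d,
    IsMinOn (fun v : Vec d => inner ℝ (gradient f (w t)) v + (1 / 2) * N v ^ 2) Set.univ Δ ∧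
    w (t + 1) = w t + γ t • Δ

/-- Sign gradient descent: `w (t+1) = w t - γ t ‖∇ f (w t)‖₁ sign (∇ f (w t))`. -/
def IsSignGradientDescent {d : ℕ} (f : Vec d → ℝ) (γ : ℕ → ℝ) (w : ℕ → Vec d) : Prop :=
  ∀ t, w (t + 1) = w t - γ t • l1Norm (gradient f (w t)) •
    (WithLp.toLp 2 (fun j => Real.sign (gradient f (w t) j)) : Vec d)

/-- Gradient descent: `w (t+1) = w t - γ t ∇ f (w t)`. -/
def IsGradientDescent {d : ℕ} (f : Vec d → ℝ) (γ : ℕ → ℝ) (w : ℕ → Vec d) : Prop :=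
  ∀ t, w (t + 1) = w t - γ t • gradient f (w t)

/-- (Greedy) coordinate descent: `w (t+1) = w t - γ t (∇ f (w t))_i e_i`, for a coordinate `i`
in which the gradient has the largest absolute value (any such coordinate). -/
def IsCoordinateDescent {d : ℕ} (f : Vec d → ℝ) (γ : ℕ → ℝ) (w : ℕ → Vec d) : Prop :=
  ∀ t, ∃ i : Fin d, (∀ j, |gradient f (w t) j| ≤ |gradient f (w t) i|) ∧
    w (t + 1) = w t - γ t • (EuclideanSpace.single i (gradient f (w t) i) : Vec d)

/-- The condition on the step sizes, `P` being the norm dual to that of the descent method: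
they are positive, have a divergent sum, and for some constant `η` (a uniform bound)
`γ t ≤ min {η, 1 / (B² L(w t))}`, where `B = max_i ‖x i‖_P` and `L` is the empirical risk. -/
def AdmissibleSteps {n d : ℕ} (P : Vec d → ℝ) (x : Fin n → Vec d) (y : Fin n → ℝ)
    (γ : ℕ → ℝ) (w : ℕ → Vec d) : Prop :=
  (∀ t, 0 < γ t) ∧ ¬ Summable γ ∧
    ∃ η : ℝ, ∀ t, γ t ≤ min η (1 / ((⨆ i, P (x i)) ^ 2 * expRisk x y (w t)))

/-- `w` classifies all data points correctly under all perturbations of size at most `ε`. -/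
def RobustAt {n d : ℕ} (P : Vec d → ℝ) (x : Fin n → Vec d) (y : Fin n → ℝ) (w : Vec d)
    (ε : ℝ) : Prop :=
  ∀ i, ∀ δ : Vec d, P δ ≤ ε → 0 < y i * inner ℝ w (x i + δ)

/-- The robustness of `w`: the supremum of the `ε ≥ 0` at which it is robust; it is `0` if `w`
misclassifies a data point. (The supremum is not attained, as `RobustAt` is a strict
inequality over a closed ball.) -/
def robustness {n d : ℕ} (P : Vec d → ℝ) (x : Fin n → Vec d) (y : Fin n → ℝ) (w : Vec d) : ℝ :=
  sSup {ε : ℝ | 0 ≤ ε ∧ RobustAt P x y w ε}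

/-- `w` is a maximally robust linear classifier against perturbations bounded in `P`. -/
def IsMaximallyRobust {n d : ℕ} (P : Vec d → ℝ) (x : Fin n → Vec d) (y : Fin n → ℝ)
    (w : Vec d) : Prop :=
  ∀ w' : Vec d, robustness P x y w' ≤ robustness P x y w

/-- The normalized iterate `w t / ‖w t‖`. -/
def direction {d : ℕ} (N : Vec d → ℝ) (w : ℕ → Vec d) (t : ℕ) : Vec d := (N (w t))⁻¹ • w t

/-- The iterates `w` converge in direction (normalized in `N`) to maximal robustness against
perturbations bounded in `P`. The four clauses:
the distance of `w t / ‖w t‖` to the set of maximally robust classifiers of norm one tends to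
zero; every limit point of `w t / ‖w t‖` is a maximally robust classifier; the robustness of
`w t` tends to the maximal one; and if the maximally robust classifier of norm one is unique,
then `w t / ‖w t‖` converges to it. -/
def ReachesMaximalRobustness {n d : ℕ} (N P : Vec d → ℝ) (x : Fin n → Vec d) (y : Fin n → ℝ)
    (w : ℕ → Vec d) : Prop :=
  (∀ ε : ℝ, 0 < ε → ∀ᶠ t in atTop, ∃ v : Vec d,
      N v = 1 ∧ IsMaximallyRobust P x y v ∧ N (direction N w t - v) < ε) ∧
  (∀ v : Vec d, MapClusterPt v atTop (direction N w) →
      N v = 1 ∧ IsMaximallyRobust P x y v) ∧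
  (∀ v : Vec d, IsMaximallyRobust P x y v →
      Tendsto (fun t => robustness P x y (w t)) atTop (𝓝 (robustness P x y v))) ∧
  (∀ v : Vec d, N v = 1 → IsMaximallyRobust P x y v →
      (∀ v' : Vec d, N v' = 1 → IsMaximallyRobust P x y v' → v' = v) →
      Tendsto (direction N w) atTop (𝓝 v))

end ImplicitRobustness

end

/-! Let m(w) be the least of the y_i⟨w, x_i⟩. By norm duality a perturbation of dual size ε lowers a
margin by at most ε‖w‖, with equality attained, so robustness is max(0, m(w)/‖w‖) (`robustness_eq`)
and its maximum is the largest margin μ on the unit sphere. Once m(w_t)/‖w_t‖ → μ, the four clauses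
follow by compactness (`reachesMaximalRobustness_of_tendsto`).

For that limit put L_t for the risk and g_t for the dual norm of its gradient. A steepest descent
direction has norm g_t and pairs with the gradient to at most -g_t². Pairing the gradient with a
max-margin vector gives g_t ≥ μ L_t. A second-order bound and the step size condition give L_{t+1} ≤
L_t - γ_t g_t²/4, so ∑ γ_t g_t² is finite and, as ∑ γ_t diverges, L_t → 0
(`tendsto_zero_of_descent`). Dividing by L_t, log L_T ≤ const - μ S_T with S_T = ∑_{t<T} γ_t g_t,
the second-order errors being summable (`log_le_of_descent`).

The same S_T bounds the growth of the iterates: ‖w_T‖ ≤ ‖w_0‖ + S_T. Since m ≥ -log L - log n,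
eliminating S_T gives m(w_T) ≥ μ‖w_T‖ - C, and ‖w_T‖ → ∞ (`tendsto_margin_div`). -/

namespace ImplicitRobustness

/-! ### Dual norms and steepest descent directions -/

section Norms

variable {d : ℕ}

lemma continuous_seminorm (N : Seminorm ℝ (Vec d)) : Continuous N :=
  continuousOn_univ.1 (N.convexOn.continuousOn isOpen_univ)

lemma exists_pos_mul_norm_le (N : Seminorm ℝ (Vec d)) (hN : ∀ v, N v = 0 → v = 0) :
    ∃ c : ℝ, 0 < c ∧ ∀ v, c * ‖v‖ ≤ N v := by
  -- The sphere is empty exactly when d = 0.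
  rcases (Metric.sphere (0 : Vec d) 1).eq_empty_or_nonempty with h | h
  · refine ⟨1, one_pos, fun v => ?_⟩
    by_cases hv : v = 0
    · simp [hv]
    · have : (‖v‖⁻¹ • v) ∈ Metric.sphere (0 : Vec d) 1 := by
        simp [norm_smul, norm_ne_zero_iff.2 hv]
      simp [h] at this
  · obtain ⟨u, hu, hmin⟩ := (isCompact_sphere (0 : Vec d) 1).exists_isMinOn h
      (continuous_seminorm N).continuousOn
    have hu0 : u ≠ 0 := by
      rintro rfl
      simp at hu
    refine ⟨N u, lt_of_le_of_ne (apply_nonneg N u) fun h0 => hu0 (hN u h0.symm), fun v => ?_⟩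
    by_cases hv : v = 0
    · simp [hv]
    · have hv' : 0 < ‖v‖ := norm_pos_iff.2 hv
      have h1 : N u ≤ N (‖v‖⁻¹ • v) :=
        hmin (by simp [norm_smul, hv'.ne'] : ‖v‖⁻¹ • v ∈ Metric.sphere (0 : Vec d) 1)
      rw [map_smul_eq_mul, Real.norm_of_nonneg (by positivity)] at h1
      calc N u * ‖v‖ ≤ ‖v‖⁻¹ * N v * ‖v‖ := by gcongr
        _ = N v := by field_simp

lemma isCompact_seminorm_le_one (N : Seminorm ℝ (Vec d)) (hN : ∀ v, N v = 0 → v = 0) :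
    IsCompact {v : Vec d | N v ≤ 1} := by
  obtain ⟨c, hc, h⟩ := exists_pos_mul_norm_le N hN
  refine (isCompact_closedBall (0 : Vec d) c⁻¹).of_isClosed_subset
    (isClosed_le (continuous_seminorm N) continuous_const) fun v hv => ?_
  rw [mem_closedBall_zero_iff, ← one_div, le_div_iff₀' hc]
  exact (h v).trans hv

lemma isCompact_seminorm_eq_one (N : Seminorm ℝ (Vec d)) (hN : ∀ v, N v = 0 → v = 0) :
    IsCompact {v : Vec d | N v = 1} :=
  (isCompact_seminorm_le_one N hN).of_isClosed_subset
    (isClosed_eq (continuous_seminorm N) continuous_const) fun _ hv => le_of_eq hv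

lemma seminorm_inv_smul (N : Seminorm ℝ (Vec d)) {v : Vec d} (hv : 0 < N v) :
    N ((N v)⁻¹ • v) = 1 := by
  rw [map_smul_eq_mul, Real.norm_of_nonneg (inv_nonneg.2 hv.le), inv_mul_cancel₀ hv.ne']

/-- Compactness of the unit ball makes the supremum a maximum, and replacing v by -v removes the
absolute value. -/
lemma exists_dualNorm_eq_inner (N : Seminorm ℝ (Vec d)) (hN : ∀ v, N v = 0 → v = 0)
    (δ : Vec d) : ∃ v, N v ≤ 1 ∧ inner ℝ δ v = dualNorm N δ ∧
      ∀ u, N u ≤ 1 → |inner ℝ δ u| ≤ dualNorm N δ := by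
  obtain ⟨v, hv, hmax⟩ := (isCompact_seminorm_le_one N hN).exists_isMaxOn
    ⟨0, by simp⟩ (f := fun v : Vec d => |inner ℝ δ v|) (by fun_prop)
  have hgr : IsGreatest {r : ℝ | ∃ v : Vec d, N v ≤ 1 ∧ r = |inner ℝ δ v|} |inner ℝ δ v| :=
    ⟨⟨v, hv, rfl⟩, by rintro _ ⟨u, hu, rfl⟩; exact hmax hu⟩
  have heq : dualNorm N δ = |inner ℝ δ v| := hgr.csSup_eq
  rcases abs_choice (inner ℝ δ v : ℝ) with h | h
  · exact ⟨v, hv, by rw [heq, h], fun u hu => heq ▸ hmax hu⟩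
  · exact ⟨-v, by simpa using hv, by rw [heq, h, inner_neg_right], fun u hu => heq ▸ hmax hu⟩

lemma dualNorm_nonneg (N : Vec d → ℝ) (δ : Vec d) : 0 ≤ dualNorm N δ := by
  refine Real.sSup_nonneg ?_
  rintro _ ⟨v, -, rfl⟩
  exact abs_nonneg _

lemma abs_inner_le_dualNorm_mul (N : Seminorm ℝ (Vec d)) (hN : ∀ v, N v = 0 → v = 0)
    (δ v : Vec d) : |inner ℝ δ v| ≤ dualNorm N δ * N v := by
  obtain ⟨_, -, -, h⟩ := exists_dualNorm_eq_inner N hN δ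
  rcases (apply_nonneg N v).eq_or_lt with h0 | h0
  · simp [hN v h0.symm]
  · have := h _ (seminorm_inv_smul N h0).le
    rw [inner_smul_right, abs_mul, abs_of_nonneg (inv_nonneg.2 h0.le), inv_mul_le_iff₀ h0] at this
    linarith

lemma dualNorm_le {N : Vec d → ℝ} {δ : Vec d} {r : ℝ} (hr : 0 ≤ r)
    (h : ∀ v, N v ≤ 1 → |inner ℝ δ v| ≤ r) : dualNorm N δ ≤ r := by
  refine Real.sSup_le ?_ hr
  rintro _ ⟨v, hv, rfl⟩
  exact h v hv

/-- By Hahn–Banach, the bidual norm is the norm. -/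
lemma exists_dualNorm_le_one_inner_eq (N : Seminorm ℝ (Vec d)) (w : Vec d) :
    ∃ u, dualNorm N u ≤ 1 ∧ inner ℝ w u = N w := by
  by_cases hw : w = 0
  · exact ⟨0, dualNorm_le zero_le_one (by simp), by simp [hw]⟩
  obtain ⟨g, hg, hle⟩ := exists_extension_of_le_sublinear
    (LinearPMap.mkSpanSingleton (K := ℝ) w (N w) hw) N
    (fun c hc v => by rw [map_smul_eq_mul, Real.norm_of_nonneg hc.le])
    (fun u v => map_add_le_add N u v) (by
      rintro ⟨v, hv⟩
      obtain ⟨c, rfl⟩ := Submodule.mem_span_singleton.1 hv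
      rw [LinearPMap.mkSpanSingleton'_apply, map_smul_eq_mul]
      simp only [RingHom.id_apply, smul_eq_mul]
      exact mul_le_mul_of_nonneg_right (le_abs_self c) (apply_nonneg N w))
  have hgw : g w = N w := by
    have := hg ⟨w, Submodule.mem_span_singleton_self w⟩
    rw [this, LinearPMap.mkSpanSingleton_apply]
  refine ⟨(InnerProductSpace.toDual ℝ (Vec d)).symm g.toContinuousLinearMap, ?_, ?_⟩
  · refine dualNorm_le zero_le_one fun v hv => ?_
    rw [InnerProductSpace.toDual_symm_apply]
    exact (N.abs_le_of_le hle v).trans hv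
  · rw [real_inner_comm, InnerProductSpace.toDual_symm_apply]
    exact hgw

lemma dualNorm_smul_le {N : Seminorm ℝ (Vec d)} (hN : ∀ v, N v = 0 → v = 0) (c : ℝ) (u : Vec d) :
    dualNorm N (c • u) ≤ |c| * dualNorm N u := by
  refine dualNorm_le (mul_nonneg (abs_nonneg c) (dualNorm_nonneg _ _)) fun v hv => ?_
  rw [real_inner_smul_left, abs_mul]
  gcongr
  exact (abs_inner_le_dualNorm_mul N hN u v).trans
    (mul_le_of_le_one_right (dualNorm_nonneg _ _) hv)

/-- A step of steepest descent has the size of the gradient, and is opposed to it. -/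
lemma norm_and_inner_of_isMinOn {N : Seminorm ℝ (Vec d)} (hN : ∀ v, N v = 0 → v = 0)
    {g Δ : Vec d}
    (h : IsMinOn (fun v : Vec d => inner ℝ g v + (1 / 2) * N v ^ 2) Set.univ Δ) :
    N Δ = dualNorm N g ∧ inner ℝ g Δ ≤ -dualNorm N g ^ 2 := by
  obtain ⟨u, hu, hgu, -⟩ := exists_dualNorm_eq_inner N hN g
  have hP := dualNorm_nonneg N g
  -- With P the dual norm of g, this test vector has value at most -P²/2, whereas the value at Δ is
  -- at least -P·N Δ + N Δ²/2. The difference is a square.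
  have h1 := h (Set.mem_univ (-dualNorm N g • u))
  simp only [Set.mem_ofPred_eq, inner_smul_right, hgu, map_smul_eq_mul, norm_neg,
    Real.norm_of_nonneg hP] at h1
  have h2 : (dualNorm N g * N u) ^ 2 ≤ dualNorm N g ^ 2 := by
    have := apply_nonneg N u
    gcongr
    exact mul_le_of_le_one_right hP hu
  have h3 := neg_le_of_abs_le (abs_inner_le_dualNorm_mul N hN g Δ)
  have h4 : (N Δ - dualNorm N g) ^ 2 ≤ 0 := by nlinarith
  have h5 : N Δ = dualNorm N g := by
    have := pow_eq_zero_iff two_ne_zero |>.1 (le_antisymm h4 (sq_nonneg _))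
    linarith
  refine ⟨h5, ?_⟩
  rw [h5] at h1
  linarith

/-- With P the dual norm of g, every value is at least -P·N v + N v²/2 ≥ -P²/2, and Δ does not
exceed this bound. Serves to recognize the three concrete methods as steepest descent. -/
lemma isMinOn_of_norm_and_inner {N : Seminorm ℝ (Vec d)} (hN : ∀ v, N v = 0 → v = 0)
    {g Δ : Vec d} (h1 : N Δ ≤ dualNorm N g) (h2 : inner ℝ g Δ ≤ -dualNorm N g ^ 2) :
    IsMinOn (fun v : Vec d => inner ℝ g v + (1 / 2) * N v ^ 2) Set.univ Δ := by
  intro v _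
  have h3 := neg_le_of_abs_le (abs_inner_le_dualNorm_mul N hN g v)
  have h4 : N Δ ^ 2 ≤ dualNorm N g ^ 2 := by
    have := apply_nonneg N Δ
    gcongr
  simp only [Set.mem_ofPred_eq]
  nlinarith [sq_nonneg (N v - dualNorm N g)]

end Norms

end ImplicitRobustness

namespace ImplicitRobustness

lemma _root_.MapClusterPt.eq_of_tendsto {α X : Type*} [TopologicalSpace X] [T2Space X]
    {l : Filter α} {f : α → X} {a b : X} (ha : MapClusterPt a l f) (hb : Tendsto f l (𝓝 b)) :
    a = b :=
  eq_of_nhds_neBot (NeBot.mono ha (inf_le_inf_left _ hb))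

/-! ### Robustness as normalized margin -/

section Margin

variable {n d : ℕ}

/-- The (unnormalized) margin of a linear classifier. -/
noncomputable def margin (x : Fin n → Vec d) (y : Fin n → ℝ) (w : Vec d) : ℝ :=
  ⨅ i, y i * inner ℝ w (x i)

lemma margin_le (x : Fin n → Vec d) (y : Fin n → ℝ) (w : Vec d) (i : Fin n) :
    margin x y w ≤ y i * inner ℝ w (x i) :=
  ciInf_le (Finite.bddBelow_range _) i

lemma exists_margin_eq [NeZero n] (x : Fin n → Vec d) (y : Fin n → ℝ) (w : Vec d) :
    ∃ i, y i * inner ℝ w (x i) = margin x y w :=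
  exists_eq_ciInf_of_finite

lemma le_margin_iff [NeZero n] {x : Fin n → Vec d} {y : Fin n → ℝ} {w : Vec d} {r : ℝ} :
    r ≤ margin x y w ↔ ∀ i, r ≤ y i * inner ℝ w (x i) :=
  le_ciInf_iff (Finite.bddBelow_range _)

lemma continuous_margin [NeZero n] (x : Fin n → Vec d) (y : Fin n → ℝ) :
    Continuous (margin x y) := by
  have h : margin x y = fun w => Finset.univ.inf' Finset.univ_nonempty
      fun i => y i * inner ℝ w (x i) := by
    funext w
    rw [margin, Finset.inf'_univ_eq_ciInf]
  rw [h]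
  exact Continuous.finset_inf'_apply _ fun i _ => by fun_prop

lemma margin_smul (x : Fin n → Vec d) (y : Fin n → ℝ) {c : ℝ} (hc : 0 ≤ c) (w : Vec d) :
    margin x y (c • w) = c * margin x y w := by
  rw [margin, margin, Real.mul_iInf_of_nonneg hc]
  congr 1
  funext i
  rw [real_inner_smul_left]
  ring

lemma margin_zero (x : Fin n → Vec d) (y : Fin n → ℝ) : margin x y 0 = 0 := by
  simpa using margin_smul x y le_rfl (0 : Vec d)

lemma abs_mul_eq_of_sign {s : ℝ} (hs : s = 1 ∨ s = -1) (r : ℝ) : |s * r| = |r| := by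
  rcases hs with rfl | rfl <;> simp

variable {x : Fin n → Vec d} {y : Fin n → ℝ} {N : Seminorm ℝ (Vec d)}

/-- The worst perturbation of x_i is -ε y_i u, where u has dual norm at most one and ⟨w, u⟩ = N w;
it lowers the margin by ε N w. -/
lemma robustAt_iff [NeZero n] (hN : ∀ v, N v = 0 → v = 0) (hy : ∀ i, y i = 1 ∨ y i = -1)
    (w : Vec d) {ε : ℝ} (hε : 0 ≤ ε) :
    RobustAt (dualNorm N) x y w ε ↔ ε * N w < margin x y w := by
  constructor
  · intro h
    obtain ⟨i, hi⟩ := exists_margin_eq x y w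
    obtain ⟨u, hu, hwu⟩ := exists_dualNorm_le_one_inner_eq N w
    have habs : |-(ε * y i)| = ε := by rw [abs_neg, mul_comm, abs_mul_eq_of_sign (hy i), abs_of_nonneg hε]
    have h1 := h i (-(ε * y i) • u) ((dualNorm_smul_le hN _ _).trans
      (by rw [habs]; exact mul_le_of_le_one_right hε hu))
    rw [inner_add_right, inner_smul_right, hwu, mul_add, hi] at h1
    have hy2 : y i * y i = 1 := by rcases hy i with h | h <;> simp [h]
    have h2 : y i * (-(ε * y i) * N w) = -(ε * N w) := by linear_combination (-(ε * N w)) * hy2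
    linarith
  · intro h i δ hδ
    rw [inner_add_right, mul_add]
    have h1 := margin_le x y w i
    have h2 : |y i * inner ℝ w δ| ≤ ε * N w := by
      rw [abs_mul_eq_of_sign (hy i), real_inner_comm]
      exact (abs_inner_le_dualNorm_mul N hN δ w).trans
        (mul_le_mul_of_nonneg_right hδ (apply_nonneg N w))
    have h3 := neg_le_of_abs_le h2
    linarith

lemma robustness_eq [NeZero n] (hN : ∀ v, N v = 0 → v = 0) (hy : ∀ i, y i = 1 ∨ y i = -1)
    (w : Vec d) : robustness (dualNorm N) x y w = max 0 (margin x y w / N w) := by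
  have hset : {ε : ℝ | 0 ≤ ε ∧ RobustAt (dualNorm N) x y w ε} =
      {ε : ℝ | 0 ≤ ε ∧ ε * N w < margin x y w} := by
    ext ε
    exact and_congr_right fun hε => robustAt_iff hN hy w hε
  rw [robustness, hset]
  rcases le_or_gt (margin x y w) 0 with hm | hm
  · rw [max_eq_left (div_nonpos_of_nonpos_of_nonneg hm (apply_nonneg N w))]
    -- No ε qualifies, and the real supremum of the empty set is 0. The case w = 0 falls here, as 0
    -- / 0 = 0.
    have : {ε : ℝ | 0 ≤ ε ∧ ε * N w < margin x y w} = ∅ := by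
      refine Set.eq_empty_of_forall_notMem fun ε hε => ?_
      have := mul_nonneg hε.1 (apply_nonneg N w)
      linarith [hε.2]
    rw [this, Real.sSup_empty]
  · have hw : 0 < N w := by
      refine lt_of_le_of_ne (apply_nonneg N w) fun h0 => ?_
      rw [hN w h0.symm, margin_zero] at hm
      exact lt_irrefl _ hm
    have hpos : 0 < margin x y w / N w := div_pos hm hw
    have : {ε : ℝ | 0 ≤ ε ∧ ε * N w < margin x y w} = Set.Ico 0 (margin x y w / N w) := by
      ext ε
      simp [lt_div_iff₀ hw]
    rw [this, csSup_Ico hpos, max_eq_right hpos.le]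

/-- The maximal margin over the unit ball is positive and attained on the unit sphere. -/
lemma exists_max_margin [NeZero n] (hN : ∀ v, N v = 0 → v = 0) (hsep : LinearlySeparable x y) :
    ∃ v, N v = 1 ∧ 0 < margin x y v ∧ ∀ w, margin x y w ≤ margin x y v * N w := by
  obtain ⟨w₀, hw₀⟩ := hsep
  have hpos₀ : 0 < margin x y w₀ := by
    obtain ⟨i, hi⟩ := exists_margin_eq x y w₀
    exact hi ▸ hw₀ i
  have hNpos : ∀ w, w ≠ 0 → 0 < N w := fun w hw =>
    lt_of_le_of_ne (apply_nonneg N w) fun h0 => hw (hN w h0.symm)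
  have hw0 : w₀ ≠ 0 := by
    rintro rfl
    simp [margin_zero] at hpos₀
  obtain ⟨v, hv, hmax⟩ := (isCompact_seminorm_eq_one N hN).exists_isMaxOn
    ⟨_, seminorm_inv_smul N (hNpos w₀ hw0)⟩ (continuous_margin x y).continuousOn
  have key : ∀ w, margin x y w ≤ margin x y v * N w := by
    intro w
    by_cases hw : w = 0
    · simp [hw, margin_zero]
    · have h1 : margin x y ((N w)⁻¹ • w) ≤ margin x y v := hmax (seminorm_inv_smul N (hNpos w hw))
      rw [margin_smul x y (inv_nonneg.2 (apply_nonneg N w)), inv_mul_le_iff₀ (hNpos w hw)] at h1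
      linarith
  exact ⟨v, hv, pos_of_mul_pos_left (hpos₀.trans_le (key w₀)) (apply_nonneg N w₀), key⟩

lemma isMaximallyRobust_iff [NeZero n] (hN : ∀ v, N v = 0 → v = 0) (hy : ∀ i, y i = 1 ∨ y i = -1)
    {v₀ : Vec d} (h1 : N v₀ = 1) (hpos : 0 < margin x y v₀)
    (hmax : ∀ w, margin x y w ≤ margin x y v₀ * N w) (v : Vec d) :
    IsMaximallyRobust (dualNorm N) x y v ↔
      robustness (dualNorm N) x y v = margin x y v₀ := by
  have h0 : robustness (dualNorm N) x y v₀ = margin x y v₀ := by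
    rw [robustness_eq hN hy, h1, div_one, max_eq_right hpos.le]
  have hle : ∀ w, robustness (dualNorm N) x y w ≤ margin x y v₀ := fun w => by
    rw [robustness_eq hN hy]
    exact max_le hpos.le (div_le_of_le_mul₀ (apply_nonneg N w) hpos.le (hmax w))
  exact ⟨fun h => le_antisymm (hle v) (h0 ▸ h v₀), fun h w => h ▸ hle w⟩

lemma isMaximallyRobust_iff_margin [NeZero n] (hN : ∀ v, N v = 0 → v = 0)
    (hy : ∀ i, y i = 1 ∨ y i = -1) {v₀ : Vec d} (h1 : N v₀ = 1) (hpos : 0 < margin x y v₀)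
    (hmax : ∀ w, margin x y w ≤ margin x y v₀ * N w) {v : Vec d} (hv : N v = 1) :
    IsMaximallyRobust (dualNorm N) x y v ↔ margin x y v = margin x y v₀ := by
  rw [isMaximallyRobust_iff hN hy h1 hpos hmax, robustness_eq hN hy, hv, div_one]
  constructor
  · intro h
    rcases max_choice 0 (margin x y v) with h' | h' <;> rw [h'] at h
    · exact absurd h hpos.ne
    · exact h
  · rintro h
    rw [h, max_eq_right hpos.le]

/-- Convergence of the normalized margin to its maximum gives convergence in direction. -/
lemma reachesMaximalRobustness_of_tendsto [NeZero n] (hN : ∀ v, N v = 0 → v = 0)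
    (hy : ∀ i, y i = 1 ∨ y i = -1) {v₀ : Vec d} (h1 : N v₀ = 1) (hpos : 0 < margin x y v₀)
    (hmax : ∀ w, margin x y w ≤ margin x y v₀ * N w) {w : ℕ → Vec d}
    (hlim : Tendsto (fun t => margin x y (w t) / N (w t)) atTop (𝓝 (margin x y v₀))) :
    ReachesMaximalRobustness N (dualNorm N) x y w := by
  have hNw : ∀ᶠ t in atTop, 0 < N (w t) := by
    filter_upwards [hlim.eventually_const_lt hpos] with t ht
    refine lt_of_le_of_ne (apply_nonneg N _) fun h0 => ?_
    rw [← h0, div_zero] at ht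
    exact lt_irrefl _ ht
  have hdir : ∀ᶠ t in atTop, N (direction N w t) = 1 := by
    filter_upwards [hNw] with t ht using seminorm_inv_smul N ht
  have hmar : Tendsto (margin x y ∘ direction N w) atTop (𝓝 (margin x y v₀)) := by
    refine hlim.congr fun t => ?_
    rw [Function.comp, direction, margin_smul x y (inv_nonneg.2 (apply_nonneg N _)),
      div_eq_inv_mul]
  have hN1 : Tendsto (N ∘ direction N w) atTop (𝓝 1) :=
    tendsto_const_nhds.congr' (hdir.mono fun t ht => ht.symm)
  have hcl : ∀ v : Vec d, MapClusterPt v atTop (direction N w) →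
      N v = 1 ∧ IsMaximallyRobust (dualNorm N) x y v := by
    intro v hv
    have e1 : N v = 1 :=
      (hv.continuousAt_comp (continuous_seminorm N).continuousAt).eq_of_tendsto hN1
    have e2 : margin x y v = margin x y v₀ :=
      (hv.continuousAt_comp (continuous_margin x y).continuousAt).eq_of_tendsto hmar
    exact ⟨e1, (isMaximallyRobust_iff_margin hN hy h1 hpos hmax e1).2 e2⟩
  have hK := isCompact_seminorm_eq_one N hN
  refine ⟨fun ε hε => ?_, hcl, fun v hv => ?_, fun v hv hvm huniq => ?_⟩
  · by_contra hcon
    -- Directions that stay ε away from all optimal unit vectors infinitely often would cluster in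
    -- this closed set; but a cluster point is itself optimal, at distance 0 from itself.
    have hclosed : IsClosed {u : Vec d | ∀ v, N v = 1 → IsMaximallyRobust (dualNorm N) x y v →
        ε ≤ N (u - v)} := by
      simp only [Set.ofPred_forall]
      exact isClosed_iInter fun v => isClosed_iInter fun _ => isClosed_iInter fun _ =>
        isClosed_le continuous_const ((continuous_seminorm N).comp (by fun_prop))
    obtain ⟨u, hu, huc⟩ := (hK.inter_right hclosed).exists_mapClusterPt_of_frequently
      (l := atTop) (f := direction N w) (by
        refine ((not_eventually.1 hcon).and_eventually hdir).mono fun t ht => ⟨ht.2, ?_⟩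
        intro v hv hvm
        by_contra hlt
        exact ht.1 ⟨v, hv, hvm, not_le.1 hlt⟩)
    obtain ⟨hu1, hu2⟩ := hcl u huc
    have := hu.2 u hu1 hu2
    rw [sub_self, map_zero] at this
    linarith
  · rw [(isMaximallyRobust_iff hN hy h1 hpos hmax v).1 hv]
    simp only [robustness_eq hN hy]
    simpa [max_eq_right hpos.le] using (tendsto_const_nhds (x := (0 : ℝ))).max hlim
  · exact hK.tendsto_nhds_of_unique_mapClusterPt hdir fun u _ huc =>
      huniq u (hcl u huc).1 (hcl u huc).2

end Margin

end ImplicitRobustness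

namespace ImplicitRobustness

/-! ### The exponential risk and its gradient -/

section Descent

variable {n d : ℕ} {x : Fin n → Vec d} {y : Fin n → ℝ}

lemma inner_gradient_expRisk (x : Fin n → Vec d) (y : Fin n → ℝ) (w v : Vec d) :
    inner ℝ (gradient (expRisk x y) w) v =
      -((∑ i, Real.exp (-(y i * inner ℝ w (x i))) * (y i * inner ℝ v (x i))) / n) := by
  have h : HasFDerivAt (expRisk x y) ((n : ℝ)⁻¹ • ∑ i, Real.exp (-(y i * inner ℝ w (x i))) •
      -(y i • innerSL ℝ (x i))) w := by
    have h1 : ∀ i, HasFDerivAt (fun w : Vec d => inner ℝ w (x i)) (innerSL ℝ (x i)) w := fun i =>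
      (innerSL ℝ (x i)).hasFDerivAt.congr_of_eventuallyEq
        (Eventually.of_forall fun _ => real_inner_comm _ _)
    have h2 := (HasFDerivAt.fun_sum (u := Finset.univ)
      fun i _ => ((h1 i).const_mul (y i)).neg.exp).const_mul (n : ℝ)⁻¹
    refine h2.congr_of_eventuallyEq (Eventually.of_forall fun w => ?_)
    simp [expRisk, div_eq_inv_mul]
  rw [h.hasGradientAt.gradient, InnerProductSpace.toDual_symm_apply]
  simp [real_inner_comm, div_eq_inv_mul]

lemma expRisk_pos [NeZero n] (x : Fin n → Vec d) (y : Fin n → ℝ) (w : Vec d) :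
    0 < expRisk x y w :=
  div_pos (Finset.sum_pos (fun _ _ => Real.exp_pos _) Finset.univ_nonempty)
    (Nat.cast_pos.2 (NeZero.pos n))

/-- The term exp(-margin) is one of the summands of n times the risk. -/
lemma neg_log_expRisk_sub_log_le_margin [NeZero n] (x : Fin n → Vec d) (y : Fin n → ℝ)
    (w : Vec d) : -Real.log (expRisk x y w) - Real.log n ≤ margin x y w := by
  obtain ⟨i, hi⟩ := exists_margin_eq x y w
  have hn : (0 : ℝ) < n := Nat.cast_pos.2 (NeZero.pos n)
  have h : Real.exp (-margin x y w) ≤ expRisk x y w * n := by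
    rw [expRisk, div_mul_cancel₀ _ hn.ne', ← hi]
    exact Finset.single_le_sum (f := fun i => Real.exp (-(y i * inner ℝ w (x i))))
      (fun _ _ => (Real.exp_pos _).le) (Finset.mem_univ i)
  have := (Real.le_log_iff_exp_le (mul_pos (expRisk_pos x y w) hn)).2 h
  rw [Real.log_mul (expRisk_pos x y w).ne' hn.ne'] at this
  linarith

/-- The negative gradient is the mean of the y_i x_i weighted by the losses, whose mean is the risk.
For a max-margin v this bounds the gradient from below. -/
lemma margin_mul_expRisk_le [NeZero n] (x : Fin n → Vec d) (y : Fin n → ℝ) (w v : Vec d) :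
    margin x y v * expRisk x y w ≤ -inner ℝ (gradient (expRisk x y) w) v := by
  rw [inner_gradient_expRisk, neg_neg, expRisk, ← mul_div_assoc, Finset.mul_sum]
  refine div_le_div_of_nonneg_right (Finset.sum_le_sum fun i _ => ?_) (Nat.cast_nonneg n)
  rw [mul_comm]
  exact mul_le_mul_of_nonneg_left (margin_le x y v i) (Real.exp_pos _).le

lemma neg_inner_gradient_le {r : ℝ} (w v : Vec d) (h : ∀ i, y i * inner ℝ v (x i) ≤ r) :
    -inner ℝ (gradient (expRisk x y) w) v ≤ r * expRisk x y w := by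
  rw [inner_gradient_expRisk, neg_neg, expRisk, ← mul_div_assoc, Finset.mul_sum]
  refine div_le_div_of_nonneg_right (Finset.sum_le_sum fun i _ => ?_) (Nat.cast_nonneg n)
  rw [mul_comm]
  exact mul_le_mul_of_nonneg_right (h i) (Real.exp_pos _).le

/-- The constant 3/4 is the remainder constant of `Real.exp_bound` at order two; being below 1, it
leaves a quarter of the first-order decrease in the descent inequality. -/
lemma exp_neg_le {u : ℝ} (hu : |u| ≤ 1) : Real.exp (-u) ≤ 1 - u + 3 / 4 * u ^ 2 := by
  have h := Real.exp_bound (x := -u) (by rwa [abs_neg]) (n := 2) two_pos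
  have h2 := le_of_abs_le h
  norm_num [Finset.sum_range_succ, Nat.factorial] at h2
  linarith

/-- A second-order bound on the risk after a step `v` that changes no margin by more than one. -/
lemma expRisk_add_le {r : ℝ} (hr : r ≤ 1) (w v : Vec d) (h : ∀ i, |y i * inner ℝ v (x i)| ≤ r) :
    expRisk x y (w + v) ≤ expRisk x y w + inner ℝ (gradient (expRisk x y) w) v +
      3 / 4 * r ^ 2 * expRisk x y w := by
  have key : ∀ i, Real.exp (-(y i * inner ℝ (w + v) (x i))) ≤
      Real.exp (-(y i * inner ℝ w (x i))) +
        -(Real.exp (-(y i * inner ℝ w (x i))) * (y i * inner ℝ v (x i))) +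
        3 / 4 * r ^ 2 * Real.exp (-(y i * inner ℝ w (x i))) := by
    intro i
    have h1 := exp_neg_le ((h i).trans hr)
    have h2 : (y i * inner ℝ v (x i)) ^ 2 ≤ r ^ 2 := sq_le_sq' (neg_le_of_abs_le (h i)) (le_of_abs_le (h i))
    rw [inner_add_left, mul_add, neg_add, Real.exp_add]
    have h3 := mul_le_mul_of_nonneg_left (h1.trans (add_le_add_right (mul_le_mul_of_nonneg_left h2
      (by norm_num : (0 : ℝ) ≤ 3 / 4)) _)) (Real.exp_pos (-(y i * inner ℝ w (x i)))).le
    linarith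
  rw [inner_gradient_expRisk, expRisk, expRisk, ← mul_div_assoc, ← neg_div, ← add_div, ← add_div,
    Finset.mul_sum, ← Finset.sum_neg_distrib, ← Finset.sum_add_distrib, ← Finset.sum_add_distrib]
  gcongr with i
  exact key i

end Descent

/-! ### Real sequences satisfying a descent inequality -/

section Sequences

variable {L g γ : ℕ → ℝ} {b μ η : ℝ}

lemma sum_range_mul_sq_le (hL : ∀ t, 0 < L t) (h : ∀ t, L (t + 1) ≤ L t - γ t * g t ^ 2 / 4)
    (T : ℕ) : ∑ t ∈ Finset.range T, γ t * g t ^ 2 ≤ 4 * L 0 := by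
  have : ∑ t ∈ Finset.range T, γ t * g t ^ 2 ≤ 4 * (L 0 - L T) := by
    rw [← Finset.sum_range_sub', Finset.mul_sum]
    exact Finset.sum_le_sum fun t _ => by linarith [h t]
  linarith [hL T]

/-- A positive limit l would give g ≥ μ l, so γ would be dominated by the summable γ g² / (μ l)². -/
lemma tendsto_zero_of_descent (hL : ∀ t, 0 < L t) (hγ : ∀ t, 0 < γ t) (hns : ¬ Summable γ)
    (hμ : 0 < μ) (hg : ∀ t, μ * L t ≤ g t) (h : ∀ t, L (t + 1) ≤ L t - γ t * g t ^ 2 / 4) :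
    Tendsto L atTop (𝓝 0) := by
  have hanti : Antitone L := antitone_nat_of_succ_le fun t => by
    have := mul_nonneg (hγ t).le (sq_nonneg (g t))
    linarith [h t]
  have hbdd : BddBelow (Set.range L) := ⟨0, by rintro _ ⟨t, rfl⟩; exact (hL t).le⟩
  have hlim := tendsto_atTop_ciInf hanti hbdd
  rcases (le_ciInf fun t => (hL t).le : 0 ≤ ⨅ t, L t).eq_or_lt with h0 | h0
  · rwa [← h0] at hlim
  · refine absurd ?_ hns
    set l := ⨅ t, L t
    have hs : Summable fun t => γ t * g t ^ 2 := summable_of_sum_range_le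
      (fun t => mul_nonneg (hγ t).le (sq_nonneg _)) (sum_range_mul_sq_le hL h)
    have hpos : 0 < (μ * l) ^ 2 := by positivity
    refine Summable.of_nonneg_of_le (fun t => (hγ t).le) (fun t => ?_) (hs.mul_left ((μ * l) ^ 2)⁻¹)
    rw [inv_mul_eq_div, le_div_iff₀ hpos]
    have h1 : μ * l ≤ g t := (mul_le_mul_of_nonneg_left (ciInf_le hbdd t) hμ.le).trans (hg t)
    have := (hγ t).le
    gcongr

/-- Divide by L t and use log r ≤ r - 1. The first-order term is at least μ γ g because g ≥ μ L. The
second-order term is at most b η γ g², whose sums stay below 4 b η L 0; this is where the uniform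
step bound enters. -/
lemma log_le_of_descent (hL : ∀ t, 0 < L t) (hγ : ∀ t, 0 < γ t) (hb : 0 ≤ b)
    (hη : ∀ t, γ t ≤ η) (hμ : 0 < μ) (hg : ∀ t, μ * L t ≤ g t)
    (h : ∀ t, L (t + 1) ≤ L t - γ t * g t ^ 2 / 4)
    (h' : ∀ t, L (t + 1) ≤ L t - γ t * g t ^ 2 + b * (γ t * g t) ^ 2 * L t) (T : ℕ) :
    Real.log (L T) ≤ Real.log (L 0) + 4 * (b * η * L 0) -
      μ * ∑ t ∈ Finset.range T, γ t * g t := by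
  have step : ∀ t, Real.log (L (t + 1)) - Real.log (L t) ≤
      b * η * (γ t * g t ^ 2) - μ * (γ t * g t) := by
    intro t
    have hgp : 0 < g t := (mul_pos hμ (hL t)).trans_le (hg t)
    have h1 : L (t + 1) / L t - 1 ≤ b * (γ t * g t) ^ 2 - μ * (γ t * g t) := by
      rw [sub_le_iff_le_add, div_le_iff₀ (hL t)]
      have : μ * L t * (γ t * g t) ≤ g t * (γ t * g t) :=
        mul_le_mul_of_nonneg_right (hg t) (mul_pos (hγ t) hgp).le
      linarith [h' t]
    have h2 : b * (γ t * g t) ^ 2 ≤ b * η * (γ t * g t ^ 2) := by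
      have : b * (γ t * g t) ^ 2 = b * γ t * (γ t * g t ^ 2) := by ring
      rw [this]
      have := (hγ t).le
      gcongr
      exact hη t
    rw [← Real.log_div (hL _).ne' (hL t).ne']
    linarith [Real.log_le_sub_one_of_pos (div_pos (hL (t + 1)) (hL t))]
  have hsum : Real.log (L T) - Real.log (L 0) ≤ b * η * ∑ t ∈ Finset.range T, γ t * g t ^ 2 -
      μ * ∑ t ∈ Finset.range T, γ t * g t := by
    rw [← Finset.sum_range_sub (fun t => Real.log (L t)), Finset.mul_sum, Finset.mul_sum,
      ← Finset.sum_sub_distrib]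
    exact Finset.sum_le_sum fun t _ => step t
  have hη0 : 0 ≤ η := (hγ 0).le.trans (hη 0)
  have := mul_le_mul_of_nonneg_left (sum_range_mul_sq_le hL h T) (mul_nonneg hb hη0)
  linarith

end Sequences

/-! ### Convergence of the normalized margin -/

section Convergence

variable {n d : ℕ} {x : Fin n → Vec d} {y : Fin n → ℝ} {N : Seminorm ℝ (Vec d)}

lemma iSup_dualNorm_pos [NeZero n] (hN : ∀ v, N v = 0 → v = 0) (hsep : LinearlySeparable x y) :
    0 < ⨆ i, dualNorm N (x i) := by
  obtain ⟨w, hw⟩ := hsep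
  have h0 : x 0 ≠ 0 := fun h => by simpa [h] using hw 0
  refine lt_of_lt_of_le ?_ (le_ciSup (Finite.bddAbove_range fun i => dualNorm N (x i)) 0)
  refine lt_of_le_of_ne (dualNorm_nonneg _ _) fun h => h0 ?_
  have := abs_inner_le_dualNorm_mul N hN (x 0) (x 0)
  rw [← h, zero_mul] at this
  exact inner_self_eq_zero.1 (abs_nonpos_iff.1 this)

lemma tendsto_margin_div [NeZero n] (hN : ∀ v, N v = 0 → v = 0) (hy : ∀ i, y i = 1 ∨ y i = -1)
    (hsep : LinearlySeparable x y) {v₀ : Vec d} (h1 : N v₀ = 1) (hpos : 0 < margin x y v₀)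
    (hmax : ∀ w, margin x y w ≤ margin x y v₀ * N w) {γ : ℕ → ℝ} {w : ℕ → Vec d}
    (hw : IsSteepestDescent N (expRisk x y) γ w)
    (hγ : AdmissibleSteps (dualNorm N) x y γ w) :
    Tendsto (fun t => margin x y (w t) / N (w t)) atTop (𝓝 (margin x y v₀)) := by
  choose Δ hΔ hstep using hw
  obtain ⟨hγ0, hns, η, hγ1⟩ := hγ
  set B := ⨆ i, dualNorm N (x i)
  have hB : 0 < B := iSup_dualNorm_pos hN hsep
  set μ := margin x y v₀
  set g : ℕ → ℝ := fun t => dualNorm N (gradient (expRisk x y) (w t)) with hg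
  set L : ℕ → ℝ := fun t => expRisk x y (w t) with hLdef
  have hL : ∀ t, 0 < L t := fun t => expRisk_pos x y _
  have hNΔ : ∀ t, N (Δ t) = g t := fun t => (norm_and_inner_of_isMinOn hN (hΔ t)).1
  have hin : ∀ t, inner ℝ (gradient (expRisk x y) (w t)) (Δ t) ≤ -g t ^ 2 :=
    fun t => (norm_and_inner_of_isMinOn hN (hΔ t)).2
  have hgL : ∀ t, μ * L t ≤ g t := fun t => by
    have := neg_le_of_abs_le (abs_inner_le_dualNorm_mul N hN (gradient (expRisk x y) (w t)) v₀)
    rw [h1, mul_one] at this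
    have h2 : μ * L t ≤ _ := margin_mul_expRisk_le x y (w t) v₀
    linarith
  have hgpos : ∀ t, 0 < g t := fun t => (mul_pos hpos (hL t)).trans_le (hgL t)
  have hdata : ∀ t i, |y i * inner ℝ (Δ t) (x i)| ≤ B * g t := fun t i => by
    rw [abs_mul_eq_of_sign (hy i), real_inner_comm, ← hNΔ t]
    exact (abs_inner_le_dualNorm_mul N hN _ _).trans (mul_le_mul_of_nonneg_right
      (le_ciSup (Finite.bddAbove_range fun i => dualNorm N (x i)) i) (apply_nonneg N _))
  -- Pairing the gradient with Δ gives g² ≤ B g L; then g > 0 cancels.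
  have hgB : ∀ t, g t ≤ B * L t := fun t => by
    have h2 : _ ≤ B * g t * L t :=
      neg_inner_gradient_le (w t) (Δ t) fun i => le_of_abs_le (hdata t i)
    have h3 : g t * g t ≤ B * L t * g t := by linarith [hin t]
    exact le_of_mul_le_mul_right h3 (hgpos t)
  have hγL : ∀ t, γ t * (B ^ 2 * L t) ≤ 1 := fun t =>
    (le_div_iff₀ (mul_pos (pow_pos hB 2) (hL t))).1 ((hγ1 t).trans (min_le_right _ _))
  -- A step moves no margin by more than one, as the second-order bound requires.
  have hr : ∀ t, γ t * (B * g t) ≤ 1 := fun t => by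
    refine le_trans ?_ (hγL t)
    have := (hγ0 t).le
    calc γ t * (B * g t) ≤ γ t * (B * (B * L t)) := by gcongr; exact hgB t
      _ = γ t * (B ^ 2 * L t) := by ring
  have hdesc : ∀ t, L (t + 1) ≤ L t - γ t * g t ^ 2 + (3 / 4 * B ^ 2) * (γ t * g t) ^ 2 * L t := by
    intro t
    have h2 := expRisk_add_le (x := x) (y := y) (hr t) (w t) (γ t • Δ t) fun i => by
      rw [real_inner_smul_left, mul_left_comm, abs_mul, abs_of_pos (hγ0 t)]
      exact mul_le_mul_of_nonneg_left (hdata t i) (hγ0 t).le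
    rw [← hstep t, inner_smul_right] at h2
    have h3 := mul_le_mul_of_nonneg_left (hin t) (hγ0 t).le
    simp only [hLdef]
    linarith
  -- Since γ B² L ≤ 1, the quadratic term is at most 3/4 of γ g².
  have hdesc' : ∀ t, L (t + 1) ≤ L t - γ t * g t ^ 2 / 4 := by
    intro t
    have h2 := mul_le_mul_of_nonneg_right (hγL t) (mul_nonneg (hγ0 t).le (sq_nonneg (g t)))
    linarith [hdesc t]
  have hlim := tendsto_zero_of_descent hL hγ0 hns hpos hgL hdesc'
  have hlog := log_le_of_descent hL hγ0 (by positivity : 0 ≤ 3 / 4 * B ^ 2)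
    (fun t => (hγ1 t).trans (min_le_left _ _)) hpos hgL hdesc' hdesc
  have hNle : ∀ T, N (w T) ≤ N (w 0) + ∑ t ∈ Finset.range T, γ t * g t := by
    intro T
    induction T with
    | zero => simp
    | succ T ih =>
      rw [hstep T, Finset.sum_range_succ]
      have := map_add_le_add N (w T) (γ T • Δ T)
      rw [map_smul_eq_mul, Real.norm_of_nonneg (hγ0 T).le, hNΔ] at this
      linarith
  have hmargin : ∀ T, -Real.log (L T) - Real.log n ≤ margin x y (w T) :=
    fun T => neg_log_expRisk_sub_log_le_margin x y (w T)
  have hNtop : Tendsto (fun t => N (w t)) atTop atTop := by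
    have h2 : Tendsto (fun t => -Real.log (L t)) atTop atTop :=
      tendsto_neg_atBot_atTop.comp (Real.tendsto_log_nhdsGT_zero.comp
        (tendsto_nhdsWithin_iff.2 ⟨hlim, Eventually.of_forall hL⟩))
    refine tendsto_atTop_mono (fun t => ?_)
      ((tendsto_atTop_add_const_right _ (-Real.log n) h2).atTop_div_const hpos)
    rw [div_le_iff₀' hpos]
    exact (hmargin t).trans (hmax (w t))
  -- The sum of the γ t * g t occurs with the same factor μ in `hlog` and in μ times `hNle`, so it
  -- cancels.
  obtain ⟨C, hC⟩ : ∃ C : ℝ, ∀ T, μ * N (w T) - C ≤ margin x y (w T) :=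
    ⟨μ * N (w 0) + (Real.log (L 0) + 4 * (3 / 4 * B ^ 2 * η * L 0)) + Real.log n, fun T => by
      linarith [hmargin T, hlog T, mul_le_mul_of_nonneg_left (hNle T) hpos.le]⟩
  have hlow : Tendsto (fun t => μ - C / N (w t)) atTop (𝓝 μ) := by
    simpa using tendsto_const_nhds.sub (hNtop.const_div_atTop C)
  refine tendsto_of_tendsto_of_tendsto_of_le_of_le' hlow tendsto_const_nhds ?_ ?_ <;>
    filter_upwards [hNtop.eventually_gt_atTop 0] with t ht
  · rw [le_div_iff₀ ht, sub_mul, div_mul_cancel₀ _ ht.ne']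
    exact hC t
  · exact (div_le_iff₀ ht).2 (hmax (w t))

theorem IsSteepestDescent.reachesMaximalRobustness [NeZero n] (hN : ∀ v, N v = 0 → v = 0)
    (hy : ∀ i, y i = 1 ∨ y i = -1) (hsep : LinearlySeparable x y) {γ : ℕ → ℝ} {w : ℕ → Vec d}
    (hw : IsSteepestDescent N (expRisk x y) γ w)
    (hγ : AdmissibleSteps (dualNorm N) x y γ w) :
    ReachesMaximalRobustness N (dualNorm N) x y w := by
  obtain ⟨v₀, h1, hpos, hmax⟩ := exists_max_margin hN hsep
  exact reachesMaximalRobustness_of_tendsto hN hy h1 hpos hmax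
    (tendsto_margin_div hN hy hsep h1 hpos hmax hw hγ)

end Convergence

end ImplicitRobustness

namespace ImplicitRobustness

/-! ### The norms ℓ₁, ℓ₂, ℓ_∞ and their descent methods -/

section ConcreteNorms

variable {d : ℕ}

lemma inner_eq_sum (u v : Vec d) : inner ℝ u v = ∑ j, u j * v j := by
  simp [PiLp.inner_apply, mul_comm]

lemma abs_le_lInfNorm (v : Vec d) (j : Fin d) : |v j| ≤ lInfNorm v :=
  le_ciSup (Finite.bddAbove_range fun j => |v j|) j

lemma lInfNorm_nonneg (v : Vec d) : 0 ≤ lInfNorm v :=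
  Real.iSup_nonneg fun _ => abs_nonneg _

lemma l1Norm_nonneg (v : Vec d) : 0 ≤ l1Norm v :=
  Finset.sum_nonneg fun _ _ => abs_nonneg _

lemma l2Norm_eq_norm (v : Vec d) : l2Norm v = ‖v‖ := by
  simp [l2Norm, EuclideanSpace.norm_eq]

lemma abs_inner_le_l1Norm_mul_lInfNorm (u v : Vec d) :
    |inner ℝ u v| ≤ l1Norm u * lInfNorm v := by
  rw [inner_eq_sum, l1Norm, Finset.sum_mul]
  refine (Finset.abs_sum_le_sum_abs _ _).trans (Finset.sum_le_sum fun j _ => ?_)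
  rw [abs_mul]
  exact mul_le_mul_of_nonneg_left (abs_le_lInfNorm v j) (abs_nonneg _)

/-- The `ℓ₁` norm as a seminorm. -/
noncomputable def l1Seminorm (d : ℕ) : Seminorm ℝ (Vec d) :=
  Seminorm.of l1Norm
    (fun u v => by
      rw [l1Norm, l1Norm, l1Norm, ← Finset.sum_add_distrib]
      exact Finset.sum_le_sum fun j _ => abs_add_le (u j) (v j))
    (fun c v => by simp [l1Norm, Finset.mul_sum, abs_mul])

/-- The `ℓ_∞` norm as a seminorm. -/
noncomputable def lInfSeminorm (d : ℕ) : Seminorm ℝ (Vec d) :=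
  Seminorm.of lInfNorm
    (fun u v => Real.iSup_le (fun j => (abs_add_le (u j) (v j)).trans
      (add_le_add (abs_le_lInfNorm u j) (abs_le_lInfNorm v j)))
      (add_nonneg (lInfNorm_nonneg u) (lInfNorm_nonneg v)))
    (fun c v => by simp [lInfNorm, abs_mul, Real.mul_iSup_of_nonneg (abs_nonneg c)])

lemma coe_l1Seminorm : ⇑(l1Seminorm d) = l1Norm := rfl

lemma coe_lInfSeminorm : ⇑(lInfSeminorm d) = lInfNorm := rfl

lemma normSeminorm_eq_l2Norm : ⇑(normSeminorm ℝ (Vec d)) = l2Norm :=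
  funext fun v => (l2Norm_eq_norm v).symm

lemma eq_zero_of_l1Norm_eq_zero (v : Vec d) (h : l1Norm v = 0) : v = 0 := by
  ext j
  simpa using (Finset.sum_eq_zero_iff_of_nonneg fun j _ => abs_nonneg (v j)).1 h j (Finset.mem_univ j)

lemma eq_zero_of_lInfNorm_eq_zero (v : Vec d) (h : lInfNorm v = 0) : v = 0 := by
  ext j
  simpa using (abs_le_lInfNorm v j).trans_eq h

lemma dualNorm_eq_of_attained {N : Vec d → ℝ} {δ : Vec d} {r : ℝ} (hr : 0 ≤ r)
    (hle : ∀ v, N v ≤ 1 → |inner ℝ δ v| ≤ r) (hex : ∃ v, N v ≤ 1 ∧ |inner ℝ δ v| = r) :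
    dualNorm N δ = r := by
  refine le_antisymm (dualNorm_le hr hle) (le_csSup ⟨r, ?_⟩ ?_)
  · rintro _ ⟨v, hv, rfl⟩
    exact hle v hv
  · obtain ⟨v, hv, h⟩ := hex
    exact ⟨v, hv, h.symm⟩

lemma mul_sign_self (r : ℝ) : r * Real.sign r = |r| := by
  rcases lt_trichotomy r 0 with h | rfl | h
  · rw [Real.sign_of_neg h, abs_of_neg h, mul_neg_one]
  · simp
  · rw [Real.sign_of_pos h, abs_of_pos h, mul_one]

lemma abs_sign_le_one (r : ℝ) : |Real.sign r| ≤ 1 := by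
  rcases Real.sign_apply_eq r with h | h | h <;> simp [h]

lemma lInfNorm_sign_le_one (g : Vec d) :
    lInfNorm (WithLp.toLp 2 (fun j => Real.sign (g j)) : Vec d) ≤ 1 :=
  Real.iSup_le (fun _ => abs_sign_le_one _) zero_le_one

lemma inner_sign (g : Vec d) :
    inner ℝ g (WithLp.toLp 2 (fun j => Real.sign (g j)) : Vec d) = l1Norm g := by
  rw [inner_eq_sum]
  exact Finset.sum_congr rfl fun j _ => mul_sign_self _

lemma inner_single (g : Vec d) (i : Fin d) (r : ℝ) :
    inner ℝ g (EuclideanSpace.single i r : Vec d) = g i * r := by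
  simp [inner_eq_sum]

lemma l1Norm_single (i : Fin d) (r : ℝ) :
    l1Norm (EuclideanSpace.single i r : Vec d) = |r| := by
  simp [l1Norm, apply_ite abs]

lemma dualNorm_lInfNorm : dualNorm (lInfNorm (d := d)) = l1Norm := by
  funext δ
  refine dualNorm_eq_of_attained (l1Norm_nonneg δ) (fun v hv => ?_)
    ⟨_, lInfNorm_sign_le_one δ, by rw [inner_sign, abs_of_nonneg (l1Norm_nonneg δ)]⟩
  exact (abs_inner_le_l1Norm_mul_lInfNorm δ v).trans
    (mul_le_of_le_one_right (l1Norm_nonneg δ) hv)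

lemma dualNorm_l1Norm : dualNorm (l1Norm (d := d)) = lInfNorm := by
  funext δ
  refine dualNorm_eq_of_attained (lInfNorm_nonneg δ) (fun v hv => ?_) ?_
  · rw [real_inner_comm]
    exact (abs_inner_le_l1Norm_mul_lInfNorm v δ).trans
      (mul_le_of_le_one_left (lInfNorm_nonneg δ) hv)
  · rcases isEmpty_or_nonempty (Fin d) with h | h
    · exact ⟨0, by simp [l1Norm], by simp [lInfNorm, Real.iSup_of_isEmpty]⟩
    · obtain ⟨i, hi⟩ := exists_eq_ciSup_of_finite (f := fun j => |δ j|)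
      exact ⟨EuclideanSpace.single i 1, by simp [l1Norm_single],
        by rw [inner_single, mul_one]; exact hi⟩

lemma dualNorm_l2Norm : dualNorm (l2Norm (d := d)) = l2Norm := by
  funext δ
  rw [l2Norm_eq_norm]
  refine dualNorm_eq_of_attained (norm_nonneg δ) (fun v hv => ?_)
    ⟨‖δ‖⁻¹ • δ, ?_, ?_⟩
  · rw [l2Norm_eq_norm] at hv
    exact (abs_real_inner_le_norm δ v).trans (mul_le_of_le_one_right (norm_nonneg δ) hv)
  · rw [l2Norm_eq_norm, norm_smul, norm_inv, norm_norm]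
    -- Not an equality: for δ = 0 the normalized vector is 0.
    exact inv_mul_le_one
  · rw [inner_smul_right, real_inner_self_eq_norm_sq, sq, ← mul_assoc]
    by_cases h : ‖δ‖ = 0
    · simp [h]
    · rw [inv_mul_cancel₀ h, one_mul, abs_norm]

variable {f : Vec d → ℝ} {γ : ℕ → ℝ} {w : ℕ → Vec d}

/-- The sign vector attains the duality between ℓ₁ and ℓ_∞. Only the bound 1 on its norm is needed,
so a vanishing gradient is no exception. -/
lemma IsSignGradientDescent.isSteepestDescent (h : IsSignGradientDescent f γ w) :
    IsSteepestDescent lInfNorm f γ w := by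
  intro t
  have hP := l1Norm_nonneg (gradient f (w t))
  refine ⟨-(l1Norm (gradient f (w t)) •
    (WithLp.toLp 2 (fun j => Real.sign (gradient f (w t) j)) : Vec d)), ?_, ?_⟩
  · refine isMinOn_of_norm_and_inner (N := lInfSeminorm d) eq_zero_of_lInfNorm_eq_zero ?_ ?_
    · rw [map_neg_eq_map, map_smul_eq_mul, Real.norm_of_nonneg hP, coe_lInfSeminorm,
        dualNorm_lInfNorm]
      exact mul_le_of_le_one_right hP (lInfNorm_sign_le_one _)
    · rw [inner_neg_right, inner_smul_right, inner_sign, coe_lInfSeminorm, dualNorm_lInfNorm, sq]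
  · rw [h t, smul_neg, sub_eq_add_neg]

lemma IsGradientDescent.isSteepestDescent (h : IsGradientDescent f γ w) :
    IsSteepestDescent l2Norm f γ w := by
  intro t
  refine ⟨-gradient f (w t), ?_, by rw [h t, smul_neg, sub_eq_add_neg]⟩
  rw [← normSeminorm_eq_l2Norm]
  refine isMinOn_of_norm_and_inner (N := normSeminorm ℝ (Vec d)) (fun v hv => norm_eq_zero.1 hv) ?_ ?_
  · rw [map_neg_eq_map, normSeminorm_eq_l2Norm, dualNorm_l2Norm]
  · rw [inner_neg_right, real_inner_self_eq_norm_sq, normSeminorm_eq_l2Norm, dualNorm_l2Norm,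
      l2Norm_eq_norm]

lemma IsCoordinateDescent.isSteepestDescent (h : IsCoordinateDescent f γ w) :
    IsSteepestDescent l1Norm f γ w := by
  intro t
  obtain ⟨i, hi, hw⟩ := h t
  have hP : lInfNorm (gradient f (w t)) = |gradient f (w t) i| :=
    le_antisymm (Real.iSup_le hi (abs_nonneg _)) (abs_le_lInfNorm _ i)
  refine ⟨-EuclideanSpace.single i (gradient f (w t) i), ?_, by rw [hw, smul_neg, sub_eq_add_neg]⟩
  refine isMinOn_of_norm_and_inner (N := l1Seminorm d) eq_zero_of_l1Norm_eq_zero ?_ ?_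
  · rw [map_neg_eq_map, coe_l1Seminorm, l1Norm_single, dualNorm_l1Norm, hP]
  · rw [inner_neg_right, inner_single, coe_l1Seminorm, dualNorm_l1Norm, hP, sq_abs, sq]

end ConcreteNorms

/-- In the Euclidean norm, the maximally robust direction is unique. -/
lemma existsUnique_isMaximallyRobust_l2Norm {n d : ℕ} [NeZero n] {x : Fin n → Vec d}
    {y : Fin n → ℝ} (hy : ∀ i, y i = 1 ∨ y i = -1) (hsep : LinearlySeparable x y) :
    ∃ v, l2Norm v = 1 ∧ IsMaximallyRobust l2Norm x y v ∧
      ∀ v', l2Norm v' = 1 → IsMaximallyRobust l2Norm x y v' → v' = v := by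
  have hN : ∀ v, normSeminorm ℝ (Vec d) v = 0 → v = 0 := fun v hv => norm_eq_zero.1 hv
  obtain ⟨v, hv, hpos, hmax⟩ := exists_max_margin hN hsep
  have hiff := fun {u : Vec d} (hu : normSeminorm ℝ (Vec d) u = 1) =>
    isMaximallyRobust_iff_margin hN hy hv hpos hmax hu
  simp only [normSeminorm_eq_l2Norm, dualNorm_l2Norm] at hiff hv hmax
  refine ⟨v, hv, (hiff hv).2 rfl, fun u hu hum => ?_⟩
  -- The margin is superadditive, so u + v has margin at least twice the maximum and hence norm at
  -- least 2; the parallelogram law then forces u = v.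
  have h1 : margin x y v + margin x y v ≤ margin x y (u + v) := by
    refine le_margin_iff.2 fun i => ?_
    rw [inner_add_left, mul_add]
    exact add_le_add (((hiff hu).1 hum).symm.trans_le (margin_le x y u i)) (margin_le x y v i)
  have h2 : 2 ≤ ‖u + v‖ := by
    rw [← l2Norm_eq_norm]
    refine le_of_mul_le_mul_left ?_ hpos
    linarith [hmax (u + v)]
  have h3 := parallelogram_law_with_norm ℝ u v
  rw [l2Norm_eq_norm] at hu hv
  rw [hu, hv] at h3
  have h4 : ‖u - v‖ * ‖u - v‖ = 0 := le_antisymm (by nlinarith) (mul_self_nonneg _)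
  exact sub_eq_zero.1 (norm_eq_zero.1 (mul_self_eq_zero.1 h4))

end ImplicitRobustness

theorem mainTheorem1 {n d : ℕ} (hn : 0 < n)
    (x : Fin n → ImplicitRobustness.Vec d) (y : Fin n → ℝ)
    (hy : ∀ i, y i = 1 ∨ y i = -1)
    (hsep : ImplicitRobustness.LinearlySeparable x y) :
    -- steepest descent with respect to an arbitrary norm `N`
    (∀ N : Seminorm ℝ (ImplicitRobustness.Vec d), (∀ v, N v = 0 → v = 0) →
      ∀ (γ : ℕ → ℝ) (w : ℕ → ImplicitRobustness.Vec d),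
        ImplicitRobustness.IsSteepestDescent N (ImplicitRobustness.expRisk x y) γ w →
        ImplicitRobustness.AdmissibleSteps (ImplicitRobustness.dualNorm N) x y γ w →
        ImplicitRobustness.ReachesMaximalRobustness N (ImplicitRobustness.dualNorm N) x y w) ∧
    -- sign gradient descent, against `ℓ₁` perturbations
    (∀ (γ : ℕ → ℝ) (w : ℕ → ImplicitRobustness.Vec d),
        ImplicitRobustness.IsSignGradientDescent (ImplicitRobustness.expRisk x y) γ w →
        ImplicitRobustness.AdmissibleSteps ImplicitRobustness.l1Norm x y γ w →
        ImplicitRobustness.ReachesMaximalRobustness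
          ImplicitRobustness.lInfNorm ImplicitRobustness.l1Norm x y w) ∧
    -- gradient descent, against `ℓ₂` perturbations: the direction converges
    (∀ (γ : ℕ → ℝ) (w : ℕ → ImplicitRobustness.Vec d),
        ImplicitRobustness.IsGradientDescent (ImplicitRobustness.expRisk x y) γ w →
        ImplicitRobustness.AdmissibleSteps ImplicitRobustness.l2Norm x y γ w →
        ImplicitRobustness.ReachesMaximalRobustness
          ImplicitRobustness.l2Norm ImplicitRobustness.l2Norm x y w ∧
        ∃ v : ImplicitRobustness.Vec d, ImplicitRobustness.l2Norm v = 1 ∧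
          ImplicitRobustness.IsMaximallyRobust ImplicitRobustness.l2Norm x y v ∧
          Tendsto (ImplicitRobustness.direction ImplicitRobustness.l2Norm w) atTop (𝓝 v)) ∧
    -- coordinate descent, against `ℓ_∞` perturbations
    (∀ (γ : ℕ → ℝ) (w : ℕ → ImplicitRobustness.Vec d),
        ImplicitRobustness.IsCoordinateDescent (ImplicitRobustness.expRisk x y) γ w →
        ImplicitRobustness.AdmissibleSteps ImplicitRobustness.lInfNorm x y γ w →
        ImplicitRobustness.ReachesMaximalRobustness
          ImplicitRobustness.l1Norm ImplicitRobustness.lInfNorm x y w) := by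

  have : NeZero n := ⟨hn.ne'⟩
  open ImplicitRobustness in
  refine ⟨fun N hN γ w hw hγ => hw.reachesMaximalRobustness hN hy hsep hγ,
    fun γ w hw hγ => ?_, fun γ w hw hγ => ?_, fun γ w hw hγ => ?_⟩
  · have key := IsSteepestDescent.reachesMaximalRobustness (N := lInfSeminorm d)
      (x := x) (y := y) (γ := γ) (w := w) eq_zero_of_lInfNorm_eq_zero hy hsep
    rw [coe_lInfSeminorm, dualNorm_lInfNorm] at key
    exact key hw.isSteepestDescent hγ
  · have hsd := hw.isSteepestDescent
    have hreach : ReachesMaximalRobustness l2Norm l2Norm x y w := by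
      have key := IsSteepestDescent.reachesMaximalRobustness (N := normSeminorm ℝ (Vec d))
        (x := x) (y := y) (γ := γ) (w := w) (fun v hv => norm_eq_zero.1 hv) hy hsep
      simp only [normSeminorm_eq_l2Norm, dualNorm_l2Norm] at key
      exact key hsd hγ
    obtain ⟨v, hv, hvm, huniq⟩ := existsUnique_isMaximallyRobust_l2Norm hy hsep
    exact ⟨hreach, v, hv, hvm, hreach.2.2.2 v hv hvm huniq⟩
  · have key := IsSteepestDescent.reachesMaximalRobustness (N := l1Seminorm d)
      (x := x) (y := y) (γ := γ) (w := w) eq_zero_of_l1Norm_eq_zero hy hsep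
    rw [coe_l1Seminorm, dualNorm_l1Norm] at key
    exact key hw.isSteepestDescent hγ
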